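/- Let $\sigma_c,\sigma_z,\epsilon\ge 0$. For $1\le d\le n$ and $U\in\mathbb R^{n\times d}$ with $U^TU=I_d$, consider the signal $x=Uc$ with $c\sim\mathcal N(0,\tfrac{\sigma_c^2}{d}I_d)$ and the measurement $y=x+z$ with independent noise $z\sim\mathcal N(0,\tfrac{\sigma_z^2}{n}I_n)$. For $H\in\mathbb R^{n\times n}$ let $$R_\epsilon(H)=\mathbb E_{c,z}\Big[\max_{\|e\|_2\le\epsilon}\|H(x+z+e)-x\|_2^2\Big]$$ be the worst-case robust risk of the linear estimator $f(y)=Hy$, and put $$\alpha=\alpha(d/n)=\begin{cases}\dfrac{\sigma_c^2-\dfrac{\epsilon\,\sigma_c\sigma_z\sqrt{d/n}}{\sqrt{\sigma_c^2+\sigma_z^2\frac dn-\epsilon^2}}}{\sigma_c^2+\sigma_z^2\frac dn}&\text{if }\sigma_c^2>\epsilon^2,\\[2ex]0&\text{otherwise.}\end{cases}$$ Then, as $d\to\infty$, the minimizer of $R_\epsilon$ among symmetric matrices $H$ is $H=\alpha UU^T$, in the following sense. (i) The estimator $\alpha UU^T$ is asymptotically optimal: for every $\delta>0$ there is a $D$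 (depending only on $\delta,\sigma_c,\sigma_z,\epsilon$) such that for all $d\ge D$, all $n\ge d$, all $U$ as above and all symmetric $H$, $R_\epsilon(\alpha UU^T)\le R_\epsilon(H)+\delta$. (ii) If $\sigma_z>0$, the minimizer converges to $\alpha UU^T$: for every $\delta>0$ and every $K$ there is a $D$ (depending only on $\delta,K,\sigma_c,\sigma_z,\epsilon$) such that for all $d\ge D$, all $n\ge d$ (with $n\le Kd$ in the borderline case $\epsilon=\sigma_c$) and all $U$ as above, $R_\epsilon$ has a unique minimizer over the symmetric matrices $H$, and it equals $a\,UU^T$ for some real $a$ with $|a-\alpha|\le\delta$. -/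

import Mathlib

open MeasureTheory ProbabilityTheory

noncomputable section

/-- The centred isotropic Gaussian law `N(0, v I)` on `ℝ^k`. -/
def isoGaussian (k : ℕ) (v : ℝ) : Measure (EuclideanSpace ℝ (Fin k)) :=
  multivariateGaussian 0 (v • (1 : Matrix (Fin k) (Fin k) ℝ))

/-- The joint law of the latent vector `c ~ N(0, σc²/d I_d)` and the independent measurement noise
`z ~ N(0, σz²/n I_n)`. -/
def modelLaw (n d : ℕ) (σc σz : ℝ) :
    Measure (EuclideanSpace ℝ (Fin d) × EuclideanSpace ℝ (Fin n)) :=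
  (isoGaussian d (σc ^ 2 / d)).prod (isoGaussian n (σz ^ 2 / n))

/-- The linear estimator `f(y) = H y`. -/
def linEst {n : ℕ} (H : Matrix (Fin n) (Fin n) ℝ) :
    EuclideanSpace ℝ (Fin n) → EuclideanSpace ℝ (Fin n) :=
  fun y ↦ Matrix.toEuclideanLin H y

/-- The worst-case squared error `max_{‖e‖ ≤ ε} ‖f (x + z + e) - x‖²` of the estimator `f`
for the signal `x` and the noise `z`. -/
def worstCaseError {n : ℕ} (ε : ℝ) (f : EuclideanSpace ℝ (Fin n) → EuclideanSpace ℝ (Fin n))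
    (x z : EuclideanSpace ℝ (Fin n)) : ℝ :=
  ⨆ e : Metric.closedBall (0 : EuclideanSpace ℝ (Fin n)) ε,
    ‖f (x + z + (e : EuclideanSpace ℝ (Fin n))) - x‖ ^ 2

/-- The `ℓ²` worst-case robust risk `R_ε(f)` of the estimator `f` for denoising `y = x + z`,
where `x = U c`. -/
def robustRisk {n d : ℕ} (U : Matrix (Fin n) (Fin d) ℝ) (σc σz ε : ℝ)
    (f : EuclideanSpace ℝ (Fin n) → EuclideanSpace ℝ (Fin n)) : ℝ :=
  ∫ p, worstCaseError ε f (Matrix.toEuclideanLin U p.1) p.2 ∂(modelLaw n d σc σz)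

/-- The shrinkage factor `α`, as a function of `σc`, `σz`, `ε` and the ratio `r = d/n`. -/
def shrinkage (σc σz ε r : ℝ) : ℝ :=
  if ε ^ 2 < σc ^ 2 then
    (σc ^ 2 - ε * σc * σz * √r / √(σc ^ 2 + σz ^ 2 * r - ε ^ 2)) / (σc ^ 2 + σz ^ 2 * r)
  else 0

/-- For a linear estimator the worst-case error is an attained maximum. -/
theorem worstCaseError_isGreatest {n : ℕ} {ε : ℝ} (hε : 0 ≤ ε) (H : Matrix (Fin n) (Fin n) ℝ)
    (x z : EuclideanSpace ℝ (Fin n)) :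
    IsGreatest ((fun e ↦ ‖linEst H (x + z + e) - x‖ ^ 2) '' Metric.closedBall 0 ε)
      (worstCaseError ε (linEst H) x z) := by
  have hc : IsCompact ((fun e ↦ ‖linEst H (x + z + e) - x‖ ^ 2) ''
      Metric.closedBall (0 : EuclideanSpace ℝ (Fin n)) ε) := by
    refine (isCompact_closedBall _ _).image ?_
    have : Continuous (linEst H) := LinearMap.continuous_of_finiteDimensional _
    fun_prop
  have := hc.isGreatest_sSup ((Metric.nonempty_closedBall.2 hε).image _)
  rwa [sSup_image'] at this

/-- For a linear estimator the worst-case error is integrable, so that the robust risk is a genuine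
expectation. -/
theorem worstCaseError_integrable {n d : ℕ} (U : Matrix (Fin n) (Fin d) ℝ) (σc σz : ℝ) {ε : ℝ}
    (hε : 0 ≤ ε) (H : Matrix (Fin n) (Fin n) ℝ) :
    Integrable (fun p : EuclideanSpace ℝ (Fin d) × EuclideanSpace ℝ (Fin n) ↦
      worstCaseError ε (linEst H) (Matrix.toEuclideanLin U p.1) p.2) (modelLaw n d σc σz) := by
  have hH : Continuous (linEst H) := LinearMap.continuous_of_finiteDimensional _
  have hU : Continuous (Matrix.toEuclideanLin U) := LinearMap.continuous_of_finiteDimensional _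
  have hcont : Continuous (fun p : EuclideanSpace ℝ (Fin d) × EuclideanSpace ℝ (Fin n) ↦
      worstCaseError ε (linEst H) (Matrix.toEuclideanLin U p.1) p.2) := by
    have := (isCompact_closedBall (0 : EuclideanSpace ℝ (Fin n)) ε).continuous_sSup
      (f := fun (p : EuclideanSpace ℝ (Fin d) × EuclideanSpace ℝ (Fin n)) e ↦
        ‖linEst H (Matrix.toEuclideanLin U p.1 + p.2 + e) - Matrix.toEuclideanLin U p.1‖ ^ 2)
      (by fun_prop)
    simpa only [worstCaseError, sSup_image'] using this
  obtain ⟨A, hA0, hA⟩ : ∃ A : ℝ, 0 ≤ A ∧ ∀ v, ‖linEst H v‖ ≤ A * ‖v‖ :=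
    ⟨‖LinearMap.toContinuousLinearMap (Matrix.toEuclideanLin H)‖, norm_nonneg _,
      (LinearMap.toContinuousLinearMap (Matrix.toEuclideanLin H)).le_opNorm⟩
  obtain ⟨B, hB0, hB⟩ : ∃ B : ℝ, 0 ≤ B ∧ ∀ v, ‖Matrix.toEuclideanLin U v‖ ≤ B * ‖v‖ :=
    ⟨‖LinearMap.toContinuousLinearMap (Matrix.toEuclideanLin U)‖, norm_nonneg _,
      (LinearMap.toContinuousLinearMap (Matrix.toEuclideanLin U)).le_opNorm⟩
  have hid : ∀ (k : ℕ) (v : ℝ), MemLp (fun x ↦ ‖x‖) 2 (isoGaussian k v) := fun k v ↦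
    (IsGaussian.memLp_id (multivariateGaussian _ _) 2 (by simp)).norm
  have : IsProbabilityMeasure (isoGaussian d (σc ^ 2 / d)) := by
    unfold isoGaussian; infer_instance
  have : IsProbabilityMeasure (isoGaussian n (σz ^ 2 / n)) := by
    unfold isoGaussian; infer_instance
  have h1 : MemLp (fun p : EuclideanSpace ℝ (Fin d) × EuclideanSpace ℝ (Fin n) ↦ ‖p.1‖) 2
      (modelLaw n d σc σz) :=
    (hid d _).comp_measurePreserving measurePreserving_fst
  have h2 : MemLp (fun p : EuclideanSpace ℝ (Fin d) × EuclideanSpace ℝ (Fin n) ↦ ‖p.2‖) 2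
      (modelLaw n d σc σz) :=
    (hid n _).comp_measurePreserving measurePreserving_snd
  have : IsProbabilityMeasure (modelLaw n d σc σz) := by
    unfold modelLaw; infer_instance
  have h3 : MemLp (fun _ : EuclideanSpace ℝ (Fin d) × EuclideanSpace ℝ (Fin n) ↦ A * ε) 2
      (modelLaw n d σc σz) := memLp_const _
  refine (((h1.const_mul (A * B + B)).add (h2.const_mul A)).add h3).integrable_sq.mono'
    hcont.aestronglyMeasurable (ae_of_all _ fun p ↦ ?_)
  obtain ⟨⟨e, he, hmax⟩, -⟩ :=
    worstCaseError_isGreatest hε H (Matrix.toEuclideanLin U p.1) p.2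
  rw [← hmax]
  simp only [Real.norm_eq_abs, abs_pow, abs_norm, Pi.add_apply]
  have he' : ‖e‖ ≤ ε := by simpa using he
  refine pow_le_pow_left₀ (norm_nonneg _) ?_ 2
  calc _ ≤ A * (B * ‖p.1‖ + ‖p.2‖ + ε) + B * ‖p.1‖ :=
        (norm_sub_le _ _).trans (add_le_add ((hA _).trans (mul_le_mul_of_nonneg_left
          ((norm_add_le _ _).trans (add_le_add ((norm_add_le _ _).trans
            (add_le_add_left (hB _) _)) he')) hA0)) (hB _))
    _ = _ := by ring

end

/-! Multiplying `H` on the left by the projection `U Uᵀ` does not increase the error, and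
conjugating it by an orthogonal map which preserves the range of `U` and fixes its complement does
not change the risk, because the Gaussian laws are rotation invariant. As the risk is convex in
`H`, averaging the conjugates of `U Uᵀ H` by the signed cyclic shifts of `ℝ^d` leads to `a U Uᵀ`,
where `a = tr (Uᵀ H U) / d`, without increasing the risk.

For `a U Uᵀ` the worst perturbation is aligned with the error, which is an isotropic Gaussian vector
of `ℝ^d` of total variance `v(a) = (a - 1)² σc² + a² σz² d/n`. Its norm concentrates at `√v(a)`, so
the risk lies between `κ_d L(a)` and `L(a)`, where `L(a) = (√v(a) + ε |a|)²` and `κ_d → 1`. The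
function `L` grows quadratically away from its minimizer `α`, uniformly in `d/n` as long as
`|σc² - ε²| + σz² d/n` is bounded below. When `σz > 0` the noise charges every open set, which makes
the risk strictly convex in `H` and its minimizer unique.
-/

/-! ### The limiting scalar problem -/

/-- The expected squared error, without perturbations, of the estimator `a U Uᵀ` for the aspect
ratio `r = d/n`. -/
noncomputable def shrinkageVariance (σc σz r a : ℝ) : ℝ :=
  (a - 1) ^ 2 * σc ^ 2 + a ^ 2 * (σz ^ 2 * r)

/-- The limit, as `d → ∞`, of the robust risk of the estimator `a U Uᵀ` for the aspect ratio
`r = d/n`. -/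
noncomputable def limitRisk (σc σz ε r a : ℝ) : ℝ :=
  (√(shrinkageVariance σc σz r a) + ε * |a|) ^ 2

theorem mul_sq_le_sq_sqrt_add_mul_abs_sub_sq {ε m β : ℝ} (hε : 0 ≤ ε) (hm : 0 ≤ m) (hβ : 0 ≤ β)
    (α a : ℝ) :
    β * (a - α) ^ 2 ≤ (√((m - ε * a) ^ 2 + β * (a - α) ^ 2) + ε * |a|) ^ 2 - m ^ 2 := by
  set s := √((m - ε * a) ^ 2 + β * (a - α) ^ 2)
  have hs : 0 ≤ s := Real.sqrt_nonneg _
  have hβa : 0 ≤ β * (a - α) ^ 2 := by positivity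
  have hs2 : s ^ 2 = (m - ε * a) ^ 2 + β * (a - α) ^ 2 := Real.sq_sqrt (by positivity)
  rcases le_total 0 a with ha | ha
  · rw [abs_of_nonneg ha]
    have hεa : 0 ≤ ε * a := mul_nonneg hε ha
    have hms : m - ε * a ≤ s := Real.le_sqrt_of_sq_le (by linarith)
    nlinarith [mul_nonneg hεa (sub_nonneg.2 hms)]
  · rw [abs_of_nonpos ha]
    have hεa : 0 ≤ ε * -a := mul_nonneg hε (neg_nonneg.2 ha)
    nlinarith [mul_nonneg hm hεa, mul_nonneg hs hεa]

section LimitProblem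

variable {σc σz ε r : ℝ}

theorem shrinkageVariance_nonneg (hr : 0 ≤ r) (a : ℝ) : 0 ≤ shrinkageVariance σc σz r a := by
  unfold shrinkageVariance
  positivity

theorem limitRisk_zero (hσc : 0 ≤ σc) : limitRisk σc σz ε r 0 = σc ^ 2 := by
  simp [limitRisk, shrinkageVariance, Real.sqrt_sq hσc]

theorem limitRisk_growth_of_le (hσc : 0 ≤ σc) (hσcε : σc ≤ ε) (hr : 0 ≤ r) (a : ℝ) :
    (ε ^ 2 - σc ^ 2 + σz ^ 2 * r) * a ^ 2 ≤ limitRisk σc σz ε r a - σc ^ 2 := by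
  set s := √(shrinkageVariance σc σz r a) with hs
  have hs2 : s ^ 2 = (a - 1) ^ 2 * σc ^ 2 + a ^ 2 * (σz ^ 2 * r) :=
    Real.sq_sqrt (shrinkageVariance_nonneg hr a)
  have hle : σc * |1 - a| ≤ s := by
    refine Real.le_sqrt_of_sq_le ?_
    rw [mul_pow, sq_abs, shrinkageVariance]
    nlinarith [show 0 ≤ a ^ 2 * (σz ^ 2 * r) by positivity]
  have hcross : σc ^ 2 * (a * (1 - a)) ≤ ε * |a| * s := calc
    σc ^ 2 * (a * (1 - a)) ≤ σc ^ 2 * (|a| * |1 - a|) := by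
      refine mul_le_mul_of_nonneg_left ?_ (sq_nonneg σc)
      exact (le_abs_self _).trans_eq (abs_mul a (1 - a))
    _ = σc * |a| * (σc * |1 - a|) := by ring
    _ ≤ ε * |a| * s := mul_le_mul (by gcongr) hle (by positivity)
        (mul_nonneg (hσc.trans hσcε) (abs_nonneg a))
  rw [limitRisk, ← hs, add_sq, mul_pow, sq_abs, hs2]
  linarith

/-- The square root `m` of the minimal value of `limitRisk` when `ε < σc`. -/
noncomputable def minimalError (σc σz ε r : ℝ) : ℝ :=
  (ε * σc ^ 2 + σc * σz * √r * √(σc ^ 2 + σz ^ 2 * r - ε ^ 2)) / (σc ^ 2 + σz ^ 2 * r)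

theorem minimalError_nonneg (hσc : 0 ≤ σc) (hσz : 0 ≤ σz) (hε : 0 ≤ ε) (hr : 0 ≤ r) :
    0 ≤ minimalError σc σz ε r := by
  unfold minimalError
  positivity

/- Here `v` denotes `shrinkageVariance` and `α` denotes `shrinkage`: the square is completed so that
`√v ≥ m - ε a`, with equality at `a = α`. -/
theorem shrinkageVariance_eq_sq_add_sq (hεσc : ε ^ 2 < σc ^ 2) (hr : 0 ≤ r) (a : ℝ) :
    shrinkageVariance σc σz r a = (minimalError σc σz ε r - ε * a) ^ 2 +
      (σc ^ 2 + σz ^ 2 * r - ε ^ 2) * (a - shrinkage σc σz ε r) ^ 2 := by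
  have hρ : 0 ≤ σz ^ 2 * r := by positivity
  have hB2 : 0 < σc ^ 2 + σz ^ 2 * r - ε ^ 2 := by linarith
  have hA : 0 < σc ^ 2 + σz ^ 2 * r := by linarith [sq_nonneg ε]
  have hBB := Real.sq_sqrt hB2.le
  have hB : 0 < √(σc ^ 2 + σz ^ 2 * r - ε ^ 2) := Real.sqrt_pos.2 hB2
  have hrr := Real.sq_sqrt hr
  rw [shrinkageVariance, minimalError, shrinkage, if_pos hεσc]
  set B := √(σc ^ 2 + σz ^ 2 * r - ε ^ 2)
  set A := σc ^ 2 + σz ^ 2 * r with hA_def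
  set m := (ε * σc ^ 2 + σc * σz * √r * B) / A with hm
  set α := (σc ^ 2 - ε * σc * σz * √r / B) / A with hα
  have hlin : ε * m + B ^ 2 * α = σc ^ 2 := by
    rw [hm, hα]
    field_simp
    linear_combination σc ^ 2 * hBB
  have hconst : m ^ 2 + B ^ 2 * α ^ 2 = σc ^ 2 := by
    rw [hm, hα]
    field_simp
    linear_combination σc ^ 2 * (σc ^ 2 + σz ^ 2 * √r ^ 2) * hBB + σc ^ 2 * A * σz ^ 2 * hrr -
      σc ^ 2 * A * hA_def
  rw [← hBB]
  linear_combination 2 * a * hlin - hconst - a ^ 2 * hBB - a ^ 2 * hA_def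

theorem shrinkage_nonneg (hσc : 0 ≤ σc) (hr : 0 ≤ r) :
    0 ≤ shrinkage σc σz ε r := by
  unfold shrinkage
  split_ifs with hεσc
  · have hB2 : 0 < σc ^ 2 + σz ^ 2 * r - ε ^ 2 := by nlinarith [mul_nonneg (sq_nonneg σz) hr]
    refine div_nonneg (sub_nonneg.2 ((div_le_iff₀ (Real.sqrt_pos.2 hB2)).2 ?_)) (by positivity)
    have h : ε * (σz * √r) ≤ σc * √(σc ^ 2 + σz ^ 2 * r - ε ^ 2) := by
      refine le_of_sq_le_sq ?_ (by positivity)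
      rw [mul_pow, mul_pow, mul_pow, Real.sq_sqrt hr, Real.sq_sqrt hB2.le]
      nlinarith [mul_nonneg (sub_nonneg.2 hεσc.le) (mul_nonneg (sq_nonneg σz) hr),
        mul_nonneg (sub_nonneg.2 hεσc.le) (sq_nonneg σc)]
    calc ε * σc * σz * √r = σc * (ε * (σz * √r)) := by ring
      _ ≤ σc * (σc * √(σc ^ 2 + σz ^ 2 * r - ε ^ 2)) := by gcongr
      _ = σc ^ 2 * √(σc ^ 2 + σz ^ 2 * r - ε ^ 2) := by ring
  · rfl

theorem mul_shrinkage_le_minimalError (hσc : 0 ≤ σc) (hσz : 0 ≤ σz) (hεσc : ε ^ 2 < σc ^ 2)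
    (hr : 0 ≤ r) : ε * shrinkage σc σz ε r ≤ minimalError σc σz ε r := by
  have hρ : 0 ≤ σz ^ 2 * r := by positivity
  have hB2 : 0 < σc ^ 2 + σz ^ 2 * r - ε ^ 2 := by linarith
  have : 0 < √(σc ^ 2 + σz ^ 2 * r - ε ^ 2) := Real.sqrt_pos.2 hB2
  have hA : 0 < σc ^ 2 + σz ^ 2 * r := by linarith [sq_nonneg ε]
  have hdiff : minimalError σc σz ε r - ε * shrinkage σc σz ε r =
      σc * σz * √r / √(σc ^ 2 + σz ^ 2 * r - ε ^ 2) := by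
    have hBB := Real.sq_sqrt hB2.le
    rw [minimalError, shrinkage, if_pos hεσc]
    field_simp
    linear_combination σc * σz * √r * hBB
  exact sub_nonneg.1 (hdiff ▸ by positivity)

theorem limitRisk_shrinkage (hσc : 0 ≤ σc) (hσz : 0 ≤ σz) (hεσc : ε ^ 2 < σc ^ 2) (hr : 0 ≤ r) :
    limitRisk σc σz ε r (shrinkage σc σz ε r) = minimalError σc σz ε r ^ 2 := by
  have h := sub_nonneg.2 (mul_shrinkage_le_minimalError hσc hσz hεσc hr)
  rw [limitRisk, shrinkageVariance_eq_sq_add_sq hεσc hr, sub_self, zero_pow two_ne_zero, mul_zero,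
    add_zero, Real.sqrt_sq h, abs_of_nonneg (shrinkage_nonneg hσc hr), sub_add_cancel]

theorem limitRisk_growth (hσc : 0 ≤ σc) (hσz : 0 ≤ σz) (hε : 0 ≤ ε) (hr : 0 ≤ r) (a : ℝ) :
    (|σc ^ 2 - ε ^ 2| + σz ^ 2 * r) * (a - shrinkage σc σz ε r) ^ 2 ≤
      limitRisk σc σz ε r a - limitRisk σc σz ε r (shrinkage σc σz ε r) := by
  by_cases hεσc : ε ^ 2 < σc ^ 2
  · rw [limitRisk_shrinkage hσc hσz hεσc hr, limitRisk,
      shrinkageVariance_eq_sq_add_sq hεσc hr, abs_of_pos (sub_pos.2 hεσc), sub_add_eq_add_sub]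
    have hρ : 0 ≤ σz ^ 2 * r := by positivity
    exact mul_sq_le_sq_sqrt_add_mul_abs_sub_sq hε (minimalError_nonneg hσc hσz hε hr)
      (by linarith) _ a
  · have hσcε : σc ≤ ε := le_of_sq_le_sq (not_lt.1 hεσc) hε
    rw [shrinkage, if_neg hεσc, sub_zero, limitRisk_zero hσc,
      abs_of_nonpos (by linarith), neg_sub]
    exact limitRisk_growth_of_le hσc hσcε hr a

theorem limitRisk_shrinkage_le (hσc : 0 ≤ σc) (hσz : 0 ≤ σz) (hε : 0 ≤ ε) (hr : 0 ≤ r) :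
    limitRisk σc σz ε r (shrinkage σc σz ε r) ≤ σc ^ 2 := by
  have h := limitRisk_growth hσc hσz hε hr 0
  rw [limitRisk_zero hσc] at h
  exact sub_nonneg.1 (le_trans (by positivity) h)

end LimitProblem

/-! ### Concentration of the norm of a Gaussian vector -/

section Moments

variable {Ω : Type*} {mΩ : MeasurableSpace Ω} {μ : Measure Ω} {X : Ω → ℝ}

theorem memLp_sq_of_memLp_four (hX : MemLp X 4 μ) : MemLp (fun ω ↦ X ω ^ 2) 2 μ := by
  have h := hX.norm_rpow_div 2
  have h42 : (4 : ENNReal) / 2 = 2 := by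
    rw [show (4 : ENNReal) = 2 * 2 by norm_num, ENNReal.mul_div_cancel_right (by simp) (by simp)]
  simpa [h42] using h

theorem one_add_sub_sq_le_sqrt {t : ℝ} (ht : 0 ≤ t) : 1 + (t - 1) / 2 - (t - 1) ^ 2 / 2 ≤ √t := by
  obtain ⟨u, hu, rfl⟩ : ∃ u : ℝ, 0 ≤ u ∧ u ^ 2 = t := ⟨√t, Real.sqrt_nonneg _, Real.sq_sqrt ht⟩
  rw [Real.sqrt_sq hu]
  nlinarith [mul_nonneg hu (mul_nonneg (add_nonneg hu zero_le_two) (sq_nonneg (u - 1)))]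

theorem sqrt_mul_one_sub_variance_le_integral [IsProbabilityMeasure μ] (hX : MemLp X 4 μ)
    (hX0 : 0 ≤ X) (hpos : 0 < ∫ ω, X ω ^ 2 ∂μ) :
    √(∫ ω, X ω ^ 2 ∂μ) * (1 - Var[fun ω ↦ X ω ^ 2; μ] / (2 * (∫ ω, X ω ^ 2 ∂μ) ^ 2)) ≤
      ∫ ω, X ω ∂μ := by
  have hX2 : MemLp (fun ω ↦ X ω ^ 2) 2 μ := memLp_sq_of_memLp_four hX
  set m := ∫ ω, X ω ^ 2 ∂μ with hm
  have hdev : Integrable (fun ω ↦ X ω ^ 2 - m) μ :=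
    (hX2.integrable one_le_two).sub (integrable_const m)
  have hlin : Integrable (fun ω ↦ 1 + (1 / (2 * m)) * (X ω ^ 2 - m)) μ :=
    (integrable_const 1).add (hdev.const_mul _)
  have hdev2 : Integrable (fun ω ↦ (X ω ^ 2 - m) ^ 2) μ := (hX2.sub (memLp_const m)).integrable_sq
  have hdev0 : ∫ ω, (X ω ^ 2 - m) ∂μ = 0 := by
    rw [integral_sub (hX2.integrable one_le_two) (integrable_const m), ← hm]
    simp
  have hvar : Var[fun ω ↦ X ω ^ 2; μ] = ∫ ω, (X ω ^ 2 - m) ^ 2 ∂μ :=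
    variance_eq_integral hX2.aestronglyMeasurable.aemeasurable
  have hpointwise (ω : Ω) :
      √m * (1 + (1 / (2 * m)) * (X ω ^ 2 - m) - (1 / (2 * m ^ 2)) * (X ω ^ 2 - m) ^ 2) ≤ X ω := by
    have h := one_add_sub_sq_le_sqrt (t := X ω ^ 2 / m) (by positivity)
    rw [Real.sqrt_div (sq_nonneg _), Real.sqrt_sq (hX0 ω), le_div_iff₀' (Real.sqrt_pos.2 hpos)] at h
    refine le_of_eq_of_le ?_ h
    field_simp
  calc √m * (1 - Var[fun ω ↦ X ω ^ 2; μ] / (2 * m ^ 2))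
      = ∫ ω, √m * (1 + (1 / (2 * m)) * (X ω ^ 2 - m) -
          (1 / (2 * m ^ 2)) * (X ω ^ 2 - m) ^ 2) ∂μ := by
        rw [integral_const_mul, integral_sub hlin (hdev2.const_mul _),
          integral_add (integrable_const 1) (hdev.const_mul _), integral_const_mul,
          integral_const_mul, hdev0, ← hvar, integral_const, probReal_univ]
        simp only [one_smul, mul_zero, add_zero]
        ring
    _ ≤ ∫ ω, X ω ∂μ :=
        integral_mono ((hlin.sub (hdev2.const_mul _)).const_mul _)
          (hX.integrable (by norm_num)) hpointwise

end Moments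

/-- The ratio `E‖g‖ / √(E‖g‖²)` for a standard Gaussian vector `g` in `ℝ^k`. -/
noncomputable def meanNormRatio (k : ℕ) : ℝ :=
  (∫ x, ‖x‖ ∂(stdGaussian (EuclideanSpace ℝ (Fin k)))) / √k

section MeanNormRatio

variable (k : ℕ)

theorem memLp_norm_stdGaussian {p : ENNReal} (hp : p ≠ ⊤) :
    MemLp (fun x ↦ ‖x‖) p (stdGaussian (EuclideanSpace ℝ (Fin k))) :=
  (IsGaussian.memLp_id _ p hp).norm

theorem integral_sq_gaussianReal : ∫ x, x ^ 2 ∂(gaussianReal 0 1) = 1 := by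
  rw [← variance_of_integral_eq_zero (X := fun x : ℝ ↦ x) (by fun_prop) (by simp),
    variance_fun_id_gaussianReal]
  rfl

theorem memLp_sq_gaussianReal : MemLp (fun x : ℝ ↦ x ^ 2) 2 (gaussianReal 0 1) :=
  memLp_sq_of_memLp_four (memLp_id_gaussianReal' 4 (by simp))

theorem integral_norm_sq_stdGaussian :
    ∫ x, ‖x‖ ^ 2 ∂(stdGaussian (EuclideanSpace ℝ (Fin k))) = k := by
  have hcoord (i : Fin k) :
      ∫ x : Fin k → ℝ, x i ^ 2 ∂(Measure.pi fun _ ↦ gaussianReal 0 1) = 1 := by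
    rw [← integral_sq_gaussianReal]
    exact integral_comp_eval (μ := fun _ : Fin k ↦ gaussianReal 0 1) (i := i)
      (f := fun x : ℝ ↦ x ^ 2) (by fun_prop)
  have hint (i : Fin k) :
      Integrable (fun x : Fin k → ℝ ↦ x i ^ 2) (Measure.pi fun _ ↦ gaussianReal 0 1) :=
    integrable_comp_eval (μ := fun _ : Fin k ↦ gaussianReal 0 1) (i := i)
      (f := fun x : ℝ ↦ x ^ 2) (memLp_sq_gaussianReal.integrable one_le_two)
  rw [← map_pi_eq_stdGaussian, integral_map (by fun_prop) (by fun_prop)]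
  simp_rw [EuclideanSpace.real_norm_sq_eq]
  rw [integral_finsetSum _ fun i _ ↦ hint i]
  simp [hcoord]

theorem variance_norm_sq_stdGaussian :
    Var[fun x ↦ ‖x‖ ^ 2; stdGaussian (EuclideanSpace ℝ (Fin k))] =
      k * Var[fun x ↦ x ^ 2; gaussianReal 0 1] := by
  have hsum : (fun x : EuclideanSpace ℝ (Fin k) ↦ ‖x‖ ^ 2) ∘ WithLp.toLp 2 =
      ∑ i, (fun x : Fin k → ℝ ↦ x i ^ 2) := by
    ext x
    simp [EuclideanSpace.real_norm_sq_eq]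
  rw [← map_pi_eq_stdGaussian, variance_map (by fun_prop) (by fun_prop), hsum,
    variance_sum_pi (X := fun _ x ↦ x ^ 2) (fun _ ↦ memLp_sq_gaussianReal)]
  simp

theorem meanNormRatio_nonneg : 0 ≤ meanNormRatio k :=
  div_nonneg (integral_nonneg fun _ ↦ norm_nonneg _) (Real.sqrt_nonneg _)

theorem meanNormRatio_le_one : meanNormRatio k ≤ 1 := by
  have h := variance_nonneg (fun x ↦ ‖x‖) (stdGaussian (EuclideanSpace ℝ (Fin k)))
  rw [variance_eq_sub (memLp_norm_stdGaussian k (by simp)), sub_nonneg] at h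
  exact div_le_one_of_le₀
    (Real.le_sqrt_of_sq_le (h.trans_eq (integral_norm_sq_stdGaussian k))) (Real.sqrt_nonneg _)

theorem one_sub_variance_div_le_meanNormRatio [NeZero k] :
    1 - Var[fun x ↦ x ^ 2; gaussianReal 0 1] / 2 / k ≤ meanNormRatio k := by
  have hk : (0 : ℝ) < k := Nat.cast_pos.2 (NeZero.pos k)
  have h := sqrt_mul_one_sub_variance_le_integral
    (memLp_norm_stdGaussian k (ENNReal.ofNat_ne_top (n := 4))) (fun x ↦ norm_nonneg x)
    (by rwa [integral_norm_sq_stdGaussian])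
  rw [integral_norm_sq_stdGaussian, variance_norm_sq_stdGaussian] at h
  rw [meanNormRatio, le_div_iff₀' (Real.sqrt_pos.2 hk)]
  refine le_of_eq_of_le ?_ h
  field_simp

theorem tendsto_meanNormRatio : Filter.Tendsto meanNormRatio Filter.atTop (nhds 1) := by
  have hlower : Filter.Tendsto (fun k : ℕ ↦ 1 - Var[fun x ↦ x ^ 2; gaussianReal 0 1] / 2 / (k : ℝ))
      Filter.atTop (nhds 1) := by
    simpa using (tendsto_const_div_atTop_nhds_zero_nat
      (Var[fun x ↦ x ^ 2; gaussianReal 0 1] / 2)).const_sub 1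
  refine tendsto_of_tendsto_of_tendsto_of_le_of_le' hlower tendsto_const_nhds ?_
    (Filter.Eventually.of_forall meanNormRatio_le_one)
  filter_upwards [Filter.eventually_ne_atTop 0] with k hk
  have : NeZero k := ⟨hk⟩
  exact one_sub_variance_div_le_meanNormRatio k

end MeanNormRatio

/-! ### Matrices acting on Euclidean space -/

section EuclideanLin

open Matrix

variable {k l m : ℕ}

theorem toEuclideanLin_mul_apply (A : Matrix (Fin m) (Fin l) ℝ) (B : Matrix (Fin l) (Fin k) ℝ)
    (x : EuclideanSpace ℝ (Fin k)) :
    toEuclideanLin (A * B) x = toEuclideanLin A (toEuclideanLin B x) := by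
  simp

theorem toEuclideanLin_one_apply (x : EuclideanSpace ℝ (Fin k)) :
    toEuclideanLin (1 : Matrix (Fin k) (Fin k) ℝ) x = x := by
  simp

theorem continuous_toEuclideanLin (A : Matrix (Fin m) (Fin k) ℝ) : Continuous (toEuclideanLin A) :=
  LinearMap.continuous_of_finiteDimensional _

theorem inner_toEuclideanLin_left (A : Matrix (Fin m) (Fin k) ℝ) (x : EuclideanSpace ℝ (Fin k))
    (y : EuclideanSpace ℝ (Fin m)) :
    inner ℝ (toEuclideanLin A x) y = inner ℝ x (toEuclideanLin Aᵀ y) := by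
  rw [← conjTranspose_eq_transpose_of_trivial, toEuclideanLin_conjTranspose_eq_adjoint,
    LinearMap.adjoint_inner_right]

theorem norm_sq_toEuclideanLin (A : Matrix (Fin m) (Fin k) ℝ) (x : EuclideanSpace ℝ (Fin k)) :
    ‖toEuclideanLin A x‖ ^ 2 = inner ℝ x (toEuclideanLin (Aᵀ * A) x) := by
  rw [← real_inner_self_eq_norm_sq, inner_toEuclideanLin_left, toEuclideanLin_mul_apply]

section Isometry

variable {U : Matrix (Fin m) (Fin k) ℝ} (hU : Uᵀ * U = 1)
include hU

theorem toEuclideanLin_transpose_apply_self (x : EuclideanSpace ℝ (Fin k)) :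
    toEuclideanLin Uᵀ (toEuclideanLin U x) = x := by
  rw [← toEuclideanLin_mul_apply, hU, toEuclideanLin_one_apply]

theorem norm_toEuclideanLin_of_transpose_mul_self (x : EuclideanSpace ℝ (Fin k)) :
    ‖toEuclideanLin U x‖ = ‖x‖ := by
  rw [← sq_eq_sq₀ (norm_nonneg _) (norm_nonneg _), norm_sq_toEuclideanLin, hU,
    toEuclideanLin_one_apply, real_inner_self_eq_norm_sq]

theorem norm_toEuclideanLin_transpose_le (y : EuclideanSpace ℝ (Fin m)) :
    ‖toEuclideanLin Uᵀ y‖ ≤ ‖y‖ := by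
  have h : ‖toEuclideanLin Uᵀ y‖ ^ 2 ≤ ‖y‖ * ‖toEuclideanLin Uᵀ y‖ := calc
    ‖toEuclideanLin Uᵀ y‖ ^ 2 = inner ℝ y (toEuclideanLin U (toEuclideanLin Uᵀ y)) := by
      rw [norm_sq_toEuclideanLin, transpose_transpose, toEuclideanLin_mul_apply]
    _ ≤ ‖y‖ * ‖toEuclideanLin U (toEuclideanLin Uᵀ y)‖ := real_inner_le_norm _ _
    _ = ‖y‖ * ‖toEuclideanLin Uᵀ y‖ := by rw [norm_toEuclideanLin_of_transpose_mul_self hU]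
  by_contra! hlt
  nlinarith [norm_nonneg y]

end Isometry

end EuclideanLin

/-! ### Isotropic Gaussian laws -/

section IsoGaussian

open Matrix

variable {k l m : ℕ} {v w s : ℝ}

instance isProbabilityMeasure_isoGaussian (k : ℕ) (v : ℝ) :
    IsProbabilityMeasure (isoGaussian k v) := by
  unfold isoGaussian; infer_instance

instance isProbabilityMeasure_modelLaw (n d : ℕ) (σc σz : ℝ) :
    IsProbabilityMeasure (modelLaw n d σc σz) := by
  unfold modelLaw; infer_instance

theorem charFun_isoGaussian (hv : 0 ≤ v) (t : EuclideanSpace ℝ (Fin k)) :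
    charFun (isoGaussian k v) t = Complex.exp (-((v * ‖t‖ ^ 2 / 2 : ℝ) : ℂ)) := by
  rw [isoGaussian, charFun_multivariateGaussian (PosSemidef.one.smul hv), smul_mulVec, one_mulVec,
    dotProduct_smul, EuclideanSpace.real_norm_sq_eq]
  simp [dotProduct, pow_two]

theorem charFun_map_toEuclideanLin (μ : Measure (EuclideanSpace ℝ (Fin k)))
    (A : Matrix (Fin m) (Fin k) ℝ) (t : EuclideanSpace ℝ (Fin m)) :
    charFun (μ.map (toEuclideanLin A)) t = charFun μ (toEuclideanLin Aᵀ t) := by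
  rw [charFun_apply, charFun_apply,
    integral_map (continuous_toEuclideanLin A).aemeasurable (by fun_prop)]
  simp_rw [inner_toEuclideanLin_left]

theorem isoGaussian_eq_map_stdGaussian (hv : 0 ≤ v) :
    isoGaussian k v = (stdGaussian (EuclideanSpace ℝ (Fin k))).map (√v • ·) := by
  have := Measure.isProbabilityMeasure_map (μ := stdGaussian (EuclideanSpace ℝ (Fin k)))
    (f := (√v • ·)) (by fun_prop)
  refine Measure.ext_of_charFun (funext fun t ↦ ?_)
  rw [charFun_isoGaussian hv, charFun_map_smul, charFun_stdGaussian, norm_smul,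
    ← Complex.ofReal_pow, mul_pow, Real.norm_eq_abs, sq_abs, Real.sq_sqrt hv]
  push_cast
  rw [neg_div]

theorem isoGaussian_map_toEuclideanLin {A : Matrix (Fin m) (Fin k) ℝ} (hA : A * Aᵀ = 1)
    (hv : 0 ≤ v) : (isoGaussian k v).map (toEuclideanLin A) = isoGaussian m v := by
  have := Measure.isProbabilityMeasure_map (μ := isoGaussian k v)
    (continuous_toEuclideanLin A).aemeasurable
  refine Measure.ext_of_charFun (funext fun t ↦ ?_)
  rw [charFun_map_toEuclideanLin, charFun_isoGaussian hv, charFun_isoGaussian hv,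
    norm_toEuclideanLin_of_transpose_mul_self (by rwa [transpose_transpose])]

theorem isoGaussian_prod_map_add (hv : 0 ≤ v) (hw : 0 ≤ w) (hs : 0 ≤ s)
    {A : Matrix (Fin m) (Fin k) ℝ} {B : Matrix (Fin m) (Fin l) ℝ}
    (hAB : v • (A * Aᵀ) + w • (B * Bᵀ) = s • 1) :
    ((isoGaussian k v).prod (isoGaussian l w)).map
      (fun p ↦ toEuclideanLin A p.1 + toEuclideanLin B p.2) = isoGaussian m s := by
  have hA := (continuous_toEuclideanLin A).measurable
  have hB := (continuous_toEuclideanLin B).measurable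
  have := Measure.isProbabilityMeasure_map (μ := isoGaussian k v) hA.aemeasurable
  have := Measure.isProbabilityMeasure_map (μ := isoGaussian l w) hB.aemeasurable
  have hconv : ((isoGaussian k v).prod (isoGaussian l w)).map
      (fun p ↦ toEuclideanLin A p.1 + toEuclideanLin B p.2) =
        (isoGaussian k v).map (toEuclideanLin A) ∗ (isoGaussian l w).map (toEuclideanLin B) := by
    rw [Measure.conv, Measure.map_prod_map _ _ hA hB,
      Measure.map_map measurable_add (hA.prodMap hB)]
    rfl
  have hvar (t : EuclideanSpace ℝ (Fin m)) :
      v * ‖toEuclideanLin Aᵀ t‖ ^ 2 + w * ‖toEuclideanLin Bᵀ t‖ ^ 2 = s * ‖t‖ ^ 2 := by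
    rw [norm_sq_toEuclideanLin, norm_sq_toEuclideanLin, transpose_transpose, transpose_transpose,
      ← real_inner_smul_right, ← real_inner_smul_right, ← inner_add_right, ← LinearMap.smul_apply,
      ← LinearMap.smul_apply, ← LinearMap.add_apply, ← map_smul, ← map_smul, ← map_add, hAB,
      map_smul, LinearMap.smul_apply, toEuclideanLin_one_apply, real_inner_smul_right,
      real_inner_self_eq_norm_sq]
  rw [hconv]
  refine Measure.ext_of_charFun (funext fun t ↦ ?_)
  rw [charFun_conv, charFun_map_toEuclideanLin, charFun_map_toEuclideanLin, charFun_isoGaussian hv,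
    charFun_isoGaussian hw, charFun_isoGaussian hs, ← Complex.exp_add, ← hvar]
  push_cast
  ring_nf

theorem integral_norm_isoGaussian [NeZero k] (hs : 0 ≤ s) :
    ∫ x, ‖x‖ ∂(isoGaussian k (s / k)) = √s * meanNormRatio k := by
  rw [isoGaussian_eq_map_stdGaussian (by positivity), integral_map (by fun_prop) (by fun_prop)]
  simp_rw [norm_smul, Real.norm_eq_abs, abs_of_nonneg (Real.sqrt_nonneg _)]
  rw [integral_const_mul, Real.sqrt_div hs, meanNormRatio, div_mul_eq_mul_div, mul_div_assoc]

theorem integral_norm_sq_isoGaussian [NeZero k] (hs : 0 ≤ s) :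
    ∫ x, ‖x‖ ^ 2 ∂(isoGaussian k (s / k)) = s := by
  rw [isoGaussian_eq_map_stdGaussian (by positivity), integral_map (by fun_prop) (by fun_prop)]
  simp_rw [norm_smul, mul_pow, Real.norm_eq_abs, sq_abs]
  rw [Real.sq_sqrt (by positivity), integral_const_mul, integral_norm_sq_stdGaussian,
    div_mul_cancel₀ s (NeZero.ne _)]

theorem integral_norm_add_const_sq_isoGaussian [NeZero k] (hs : 0 ≤ s) (b : ℝ) :
    ∫ x, (‖x‖ + b) ^ 2 ∂(isoGaussian k (s / k)) = s + 2 * b * (√s * meanNormRatio k) + b ^ 2 := by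
  have h2 : MemLp (fun x ↦ ‖x‖) 2 (isoGaussian k (s / k)) :=
    (IsGaussian.memLp_id (multivariateGaussian _ _) 2 (by simp)).norm
  have h1 : Integrable (fun x ↦ 2 * b * ‖x‖) (isoGaussian k (s / k)) :=
    (h2.integrable one_le_two).const_mul _
  have hexpand (x : EuclideanSpace ℝ (Fin k)) :
      (‖x‖ + b) ^ 2 = ‖x‖ ^ 2 + 2 * b * ‖x‖ + b ^ 2 := by ring
  have h21 : Integrable (fun x ↦ ‖x‖ ^ 2 + 2 * b * ‖x‖) (isoGaussian k (s / k)) :=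
    h2.integrable_sq.add h1
  simp_rw [hexpand]
  rw [integral_add h21 (integrable_const _),
    integral_add h2.integrable_sq h1, integral_const_mul, integral_norm_isoGaussian hs,
    integral_norm_sq_isoGaussian hs, integral_const, probReal_univ, one_smul]

end IsoGaussian

/-! ### Worst-case errors -/

section WorstCaseError

open Matrix

variable {n d : ℕ} {ε : ℝ}

section Linear

variable (hε : 0 ≤ ε) (H : Matrix (Fin n) (Fin n) ℝ) (x z : EuclideanSpace ℝ (Fin n))
include hε

theorem le_worstCaseError {e : EuclideanSpace ℝ (Fin n)} (he : ‖e‖ ≤ ε) :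
    ‖linEst H (x + z + e) - x‖ ^ 2 ≤ worstCaseError ε (linEst H) x z :=
  (worstCaseError_isGreatest hε H x z).2 ⟨e, mem_closedBall_zero_iff.2 he, rfl⟩

theorem exists_worstCaseError_eq :
    ∃ e, ‖e‖ ≤ ε ∧ worstCaseError ε (linEst H) x z = ‖linEst H (x + z + e) - x‖ ^ 2 := by
  obtain ⟨e, he, h⟩ := (worstCaseError_isGreatest hε H x z).1
  exact ⟨e, mem_closedBall_zero_iff.1 he, h.symm⟩

theorem worstCaseError_le {b : ℝ} (h : ∀ e, ‖e‖ ≤ ε → ‖linEst H (x + z + e) - x‖ ^ 2 ≤ b) :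
    worstCaseError ε (linEst H) x z ≤ b := by
  obtain ⟨e, he, heq⟩ := exists_worstCaseError_eq hε H x z
  exact heq ▸ h e he

end Linear

theorem exists_norm_add_smul_eq {E : Type*} [NormedAddCommGroup E] [NormedSpace ℝ E] [Nontrivial E]
    (hε : 0 ≤ ε) (a : ℝ) (v : E) : ∃ e, ‖e‖ ≤ ε ∧ ‖v + a • e‖ = ‖v‖ + ε * |a| := by
  obtain ⟨u, hu, huv⟩ : ∃ u : E, ‖u‖ = 1 ∧ v = ‖v‖ • u := by
    rcases eq_or_ne v 0 with rfl | hv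
    · obtain ⟨u, hu⟩ := exists_norm_eq E zero_le_one
      exact ⟨u, hu, by simp⟩
    · exact ⟨‖v‖⁻¹ • v, by simp [norm_smul, hv], by simp [smul_smul, hv]⟩
  obtain ⟨t, ht, hta⟩ : ∃ t : ℝ, |t| ≤ ε ∧ a * t = ε * |a| := by
    rcases le_total 0 a with h | h
    · exact ⟨ε, (abs_of_nonneg hε).le, by rw [abs_of_nonneg h, mul_comm]⟩
    · exact ⟨-ε, by rw [abs_neg, abs_of_nonneg hε], by rw [abs_of_nonpos h]; ring⟩
  refine ⟨t • u, by simpa [norm_smul, hu] using ht, ?_⟩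
  have haligned : v + a • t • u = (‖v‖ + ε * |a|) • u := by rw [add_smul, ← huv, smul_smul, hta]
  rw [haligned, norm_smul, hu, mul_one, Real.norm_of_nonneg (by positivity)]

theorem norm_linEst_smul_projection_sub {U : Matrix (Fin n) (Fin d) ℝ} (hU : Uᵀ * U = 1) (a : ℝ)
    (c : EuclideanSpace ℝ (Fin d)) (y : EuclideanSpace ℝ (Fin n)) :
    ‖linEst (a • (U * Uᵀ)) (toEuclideanLin U c + y) - toEuclideanLin U c‖ =
      ‖(a - 1) • c + a • toEuclideanLin Uᵀ y‖ := by
  rw [← norm_toEuclideanLin_of_transpose_mul_self hU, linEst, map_smul, LinearMap.smul_apply,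
    toEuclideanLin_mul_apply, map_add, toEuclideanLin_transpose_apply_self hU]
  simp only [map_add, map_smul]
  congr 1
  module

theorem worstCaseError_smul_projection [NeZero d] {U : Matrix (Fin n) (Fin d) ℝ} (hU : Uᵀ * U = 1)
    (hε : 0 ≤ ε) (a : ℝ) (c : EuclideanSpace ℝ (Fin d)) (z : EuclideanSpace ℝ (Fin n)) :
    worstCaseError ε (linEst (a • (U * Uᵀ))) (toEuclideanLin U c) z =
      (‖(a - 1) • c + a • toEuclideanLin Uᵀ z‖ + ε * |a|) ^ 2 := by
  set v := (a - 1) • c + a • toEuclideanLin Uᵀ z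
  have herror (e : EuclideanSpace ℝ (Fin n)) :
      ‖linEst (a • (U * Uᵀ)) (toEuclideanLin U c + z + e) - toEuclideanLin U c‖ =
        ‖v + a • toEuclideanLin Uᵀ e‖ := by
    rw [add_assoc, norm_linEst_smul_projection_sub hU, map_add, smul_add, ← add_assoc]
  refine le_antisymm (worstCaseError_le hε _ _ _ fun e he ↦ ?_) ?_
  · have hUe : ‖a • toEuclideanLin Uᵀ e‖ ≤ ε * |a| := by
      rw [norm_smul, Real.norm_eq_abs, mul_comm]
      gcongr
      exact (norm_toEuclideanLin_transpose_le hU e).trans he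
    rw [herror]
    gcongr
    exact norm_add_le_of_le le_rfl hUe
  · obtain ⟨f, hf, hfv⟩ := exists_norm_add_smul_eq hε a v
    have h := le_worstCaseError hε (a • (U * Uᵀ)) (toEuclideanLin U c) z
      (e := toEuclideanLin U f) (by rwa [norm_toEuclideanLin_of_transpose_mul_self hU])
    rwa [herror, toEuclideanLin_transpose_apply_self hU, hfv] at h

theorem worstCaseError_projection_mul_le {U : Matrix (Fin n) (Fin d) ℝ} (hU : Uᵀ * U = 1)
    (hε : 0 ≤ ε) (H : Matrix (Fin n) (Fin n) ℝ) (c : EuclideanSpace ℝ (Fin d))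
    (z : EuclideanSpace ℝ (Fin n)) :
    worstCaseError ε (linEst (U * Uᵀ * H)) (toEuclideanLin U c) z ≤
      worstCaseError ε (linEst H) (toEuclideanLin U c) z := by
  refine worstCaseError_le hε _ _ _ fun e he ↦
    le_trans ?_ (le_worstCaseError hε H (toEuclideanLin U c) z he)
  set y := toEuclideanLin U c + z + e
  have hproj : linEst (U * Uᵀ * H) y - toEuclideanLin U c =
      toEuclideanLin U (toEuclideanLin Uᵀ (linEst H y - toEuclideanLin U c)) := by
    simp only [linEst, toEuclideanLin_mul_apply, map_sub, toEuclideanLin_transpose_apply_self hU]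
  rw [hproj, norm_toEuclideanLin_of_transpose_mul_self hU]
  gcongr
  exact norm_toEuclideanLin_transpose_le hU _

theorem worstCaseError_conj_le {m : ℕ} {Q : Matrix (Fin m) (Fin n) ℝ} (hQ : Qᵀ * Q = 1)
    (hε : 0 ≤ ε) (H : Matrix (Fin m) (Fin m) ℝ) (x z : EuclideanSpace ℝ (Fin n)) :
    worstCaseError ε (linEst (Qᵀ * H * Q)) x z ≤
      worstCaseError ε (linEst H) (toEuclideanLin Q x) (toEuclideanLin Q z) := by
  refine worstCaseError_le hε _ _ _ fun e he ↦
    le_trans ?_ (le_worstCaseError hε H (toEuclideanLin Q x) (toEuclideanLin Q z)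
      (e := toEuclideanLin Q e) (by rwa [norm_toEuclideanLin_of_transpose_mul_self hQ]))
  have hconj : linEst (Qᵀ * H * Q) (x + z + e) - x = toEuclideanLin Qᵀ
      (linEst H (toEuclideanLin Q x + toEuclideanLin Q z + toEuclideanLin Q e) -
        toEuclideanLin Q x) := by
    simp only [map_sub, map_add, linEst, toEuclideanLin_mul_apply,
      toEuclideanLin_transpose_apply_self hQ]
  rw [hconj]
  gcongr
  exact norm_toEuclideanLin_transpose_le hQ _

theorem norm_sq_smul_add_smul {E : Type*} [NormedAddCommGroup E] [InnerProductSpace ℝ E] {s t : ℝ}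
    (hst : s + t = 1) (u v : E) :
    ‖s • u + t • v‖ ^ 2 = s * ‖u‖ ^ 2 + t * ‖v‖ ^ 2 - s * t * ‖u - v‖ ^ 2 := by
  obtain rfl : t = 1 - s := by linarith
  rw [norm_add_sq_real, norm_sub_sq_real, norm_smul, norm_smul, real_inner_smul_left,
    real_inner_smul_right, mul_pow, mul_pow, Real.norm_eq_abs, Real.norm_eq_abs, sq_abs, sq_abs]
  ring

theorem exists_worstCaseError_smul_add_smul_le (hε : 0 ≤ ε) {s t : ℝ} (hs : 0 ≤ s) (ht : 0 ≤ t)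
    (hst : s + t = 1) (G H : Matrix (Fin n) (Fin n) ℝ) (x z : EuclideanSpace ℝ (Fin n)) :
    ∃ e, ‖e‖ ≤ ε ∧ worstCaseError ε (linEst (s • G + t • H)) x z ≤
      s * worstCaseError ε (linEst G) x z + t * worstCaseError ε (linEst H) x z -
        s * t * ‖linEst (G - H) (x + z + e)‖ ^ 2 := by
  obtain ⟨e, he, heq⟩ := exists_worstCaseError_eq hε (s • G + t • H) x z
  refine ⟨e, he, ?_⟩
  set y := x + z + e
  have hcombo : linEst (s • G + t • H) y - x = s • (linEst G y - x) + t • (linEst H y - x) := by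
    simp only [linEst, map_add, map_smul, LinearMap.add_apply, LinearMap.smul_apply]
    obtain rfl : t = 1 - s := by linarith
    module
  have hdiff : linEst (G - H) y = (linEst G y - x) - (linEst H y - x) := by
    simp only [linEst, map_sub, LinearMap.sub_apply, sub_sub_sub_cancel_right]
  rw [heq, hcombo, norm_sq_smul_add_smul hst, hdiff]
  gcongr
  · exact le_worstCaseError hε G x z he
  · exact le_worstCaseError hε H x z he

theorem worstCaseError_smul_add_smul_le (hε : 0 ≤ ε) {s t : ℝ} (hs : 0 ≤ s) (ht : 0 ≤ t)
    (hst : s + t = 1) (G H : Matrix (Fin n) (Fin n) ℝ) (x z : EuclideanSpace ℝ (Fin n)) :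
    worstCaseError ε (linEst (s • G + t • H)) x z ≤
      s * worstCaseError ε (linEst G) x z + t * worstCaseError ε (linEst H) x z := by
  obtain ⟨e, -, he⟩ := exists_worstCaseError_smul_add_smul_le hε hs ht hst G H x z
  exact he.trans (sub_le_self _ (by positivity))

end WorstCaseError

/-! ### Averaging over orthogonal transformations -/

section SignedShift

open Matrix

variable {d : ℕ}

/-- The signed cyclic shift `e_i ↦ s_i e_{i+k}`. Conjugation by all of them averages a matrix to a
multiple of the identity. -/
def signedShift (s : Fin d → ℤˣ) (k : Fin d) : Matrix (Fin d) (Fin d) ℝ :=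
  of fun l i ↦ if l = i + k then ((s i : ℤ) : ℝ) else 0

theorem signedShift_neg (s : Fin d → ℤˣ) (k : Fin d) : signedShift (-s) k = -signedShift s k := by
  ext l i
  by_cases h : l = i + k <;> simp [signedShift, h]

theorem signedShift_conj_apply (s : Fin d → ℤˣ) (k : Fin d) (G : Matrix (Fin d) (Fin d) ℝ)
    (i j : Fin d) :
    ((signedShift s k)ᵀ * G * signedShift s k) i j =
      ((s i * s j : ℤˣ) : ℤ) * G (i + k) (j + k) := by
  simp only [mul_apply, signedShift, transpose_apply, of_apply, ite_mul, mul_ite, zero_mul,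
    mul_zero, Finset.sum_ite_eq', Finset.mem_univ, if_true]
  push_cast
  ring

theorem signedShift_transpose_mul_self [NeZero d] (s : Fin d → ℤˣ) (k : Fin d) :
    (signedShift s k)ᵀ * signedShift s k = 1 := by
  ext i j
  rw [← Matrix.mul_one (signedShift s k)ᵀ, signedShift_conj_apply]
  rcases eq_or_ne i j with rfl | hij
  · simp
  · simp [hij]

theorem sum_signedShift : ∑ x : (Fin d → ℤˣ) × Fin d, signedShift x.1 x.2 = 0 := by
  have h := ((Equiv.neg (Fin d → ℤˣ)).prodCongr (Equiv.refl (Fin d))).sum_comp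
    fun x ↦ signedShift x.1 x.2
  simp only [Equiv.prodCongr_apply, Prod.map_fst, Prod.map_snd, Equiv.neg_apply, signedShift_neg,
    Equiv.refl_apply, Finset.sum_neg_distrib] at h
  linear_combination (norm := module) (-1 / 2 : ℝ) • h

theorem sum_signs_mul_eq_zero {i j : Fin d} (hij : i ≠ j) :
    ∑ s : Fin d → ℤˣ, (((s i * s j : ℤˣ) : ℤ) : ℝ) = 0 := by
  have h := Equiv.sum_comp (Equiv.mulLeft (Pi.mulSingle i (-1) : Fin d → ℤˣ))
    fun s : Fin d → ℤˣ ↦ (((s i * s j : ℤˣ) : ℤ) : ℝ)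
  simp only [Equiv.coe_mulLeft, Pi.mul_apply, Pi.mulSingle_eq_same, Pi.mulSingle_eq_of_ne' hij,
    one_mul, neg_mul, Units.val_neg, Int.cast_neg, Finset.sum_neg_distrib] at h
  exact self_eq_neg.1 h.symm

theorem sum_signedShift_conj [NeZero d] (G : Matrix (Fin d) (Fin d) ℝ) :
    ∑ x : (Fin d → ℤˣ) × Fin d, (signedShift x.1 x.2)ᵀ * G * signedShift x.1 x.2 =
      (Fintype.card (Fin d → ℤˣ) * G.trace) • (1 : Matrix (Fin d) (Fin d) ℝ) := by
  ext i j
  simp only [Matrix.sum_apply, signedShift_conj_apply, Fintype.sum_prod_type, Matrix.smul_apply,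
    ← Finset.mul_sum]
  rw [← Finset.sum_mul]
  rcases eq_or_ne i j with rfl | hij
  · have htrace : ∑ k, G (i + k) (i + k) = G.trace :=
      Equiv.sum_comp (Equiv.addLeft i) fun k ↦ G k k
    simp [htrace]
  · rw [sum_signs_mul_eq_zero hij]
    simp [hij]

end SignedShift

section ExtendOrthogonal

open Matrix

variable {n d : ℕ} {U : Matrix (Fin n) (Fin d) ℝ}

/-- The endomorphism acting as `V` on the range of the isometry `U` and as the identity on its
orthogonal complement. -/
def extendOrthogonal (U : Matrix (Fin n) (Fin d) ℝ) (V : Matrix (Fin d) (Fin d) ℝ) :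
    Matrix (Fin n) (Fin n) ℝ :=
  U * V * Uᵀ + (1 - U * Uᵀ)

theorem extendOrthogonal_transpose (U : Matrix (Fin n) (Fin d) ℝ) (V : Matrix (Fin d) (Fin d) ℝ) :
    (extendOrthogonal U V)ᵀ = extendOrthogonal U Vᵀ := by
  simp [extendOrthogonal, Matrix.mul_assoc]

variable (hU : Uᵀ * U = 1)
include hU

theorem extendOrthogonal_mul (V : Matrix (Fin d) (Fin d) ℝ) :
    extendOrthogonal U V * U = U * V := by
  simp only [extendOrthogonal, Matrix.add_mul, Matrix.sub_mul, Matrix.mul_assoc, hU,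
    Matrix.mul_one, Matrix.one_mul, sub_self, add_zero]

theorem extendOrthogonal_mul_extendOrthogonal (V W : Matrix (Fin d) (Fin d) ℝ) :
    extendOrthogonal U V * extendOrthogonal U W = extendOrthogonal U (V * W) := by
  rw [show extendOrthogonal U W = U * W * Uᵀ + (1 - U * Uᵀ) from rfl, Matrix.mul_add,
    Matrix.mul_sub, Matrix.mul_one, Matrix.mul_assoc U, ← Matrix.mul_assoc _ U,
    ← Matrix.mul_assoc _ U, extendOrthogonal_mul hU, extendOrthogonal, extendOrthogonal]
  simp only [Matrix.mul_assoc]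
  abel

theorem extendOrthogonal_transpose_mul_self {V : Matrix (Fin d) (Fin d) ℝ} (hV : Vᵀ * V = 1) :
    (extendOrthogonal U V)ᵀ * extendOrthogonal U V = 1 := by
  rw [extendOrthogonal_transpose, extendOrthogonal_mul_extendOrthogonal hU, hV, extendOrthogonal,
    Matrix.mul_one, add_sub_cancel]

theorem extendOrthogonal_conj (V : Matrix (Fin d) (Fin d) ℝ) (H : Matrix (Fin n) (Fin n) ℝ) :
    (extendOrthogonal U V)ᵀ * (U * Uᵀ * H) * extendOrthogonal U V =
      U * (Vᵀ * (Uᵀ * H * U) * V) * Uᵀ + U * Vᵀ * (Uᵀ * H * (1 - U * Uᵀ)) := by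
  rw [Matrix.mul_assoc U, ← Matrix.mul_assoc _ U, extendOrthogonal_transpose,
    extendOrthogonal_mul hU, extendOrthogonal, Matrix.mul_add]
  simp only [Matrix.mul_assoc]

theorem sum_extendOrthogonal_signedShift_conj [NeZero d] (H : Matrix (Fin n) (Fin n) ℝ) :
    ∑ x : (Fin d → ℤˣ) × Fin d, (extendOrthogonal U (signedShift x.1 x.2))ᵀ * (U * Uᵀ * H) *
        extendOrthogonal U (signedShift x.1 x.2) =
      (Fintype.card (Fin d → ℤˣ) * (Uᵀ * H * U).trace) • (U * Uᵀ) := by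
  simp_rw [extendOrthogonal_conj hU]
  rw [Finset.sum_add_distrib, ← Matrix.sum_mul, ← Matrix.mul_sum, sum_signedShift_conj,
    ← Matrix.sum_mul, ← Matrix.mul_sum, ← transpose_sum, sum_signedShift, transpose_zero,
    Matrix.mul_zero, Matrix.zero_mul, add_zero, Matrix.mul_smul, Matrix.mul_one, Matrix.smul_mul]

end ExtendOrthogonal

section RobustRisk

open Matrix

variable {n d : ℕ} {U : Matrix (Fin n) (Fin d) ℝ} {σc σz ε : ℝ}

theorem convexOn_robustRisk (hε : 0 ≤ ε) :
    ConvexOn ℝ Set.univ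
      (fun H : Matrix (Fin n) (Fin n) ℝ ↦ robustRisk U σc σz ε (linEst H)) := by
  refine ⟨convex_univ, fun G _ H _ s t hs ht hst ↦ ?_⟩
  have hG := (worstCaseError_integrable U σc σz hε G).const_mul s
  have hH := (worstCaseError_integrable U σc σz hε H).const_mul t
  simp only [robustRisk, smul_eq_mul]
  rw [← integral_const_mul, ← integral_const_mul, ← integral_add hG hH]
  exact integral_mono (worstCaseError_integrable U σc σz hε _) (hG.add hH) fun p ↦
    worstCaseError_smul_add_smul_le hε hs ht hst G H (toEuclideanLin U p.1) p.2

theorem robustRisk_projection_mul_le (hU : Uᵀ * U = 1) (hε : 0 ≤ ε)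
    (H : Matrix (Fin n) (Fin n) ℝ) :
    robustRisk U σc σz ε (linEst (U * Uᵀ * H)) ≤ robustRisk U σc σz ε (linEst H) :=
  integral_mono (worstCaseError_integrable U σc σz hε _) (worstCaseError_integrable U σc σz hε H)
    fun p ↦ worstCaseError_projection_mul_le hU hε H p.1 p.2

theorem measurePreserving_modelLaw {V : Matrix (Fin d) (Fin d) ℝ} {Q : Matrix (Fin n) (Fin n) ℝ}
    (hV : V * Vᵀ = 1) (hQ : Q * Qᵀ = 1) :
    MeasurePreserving (Prod.map (toEuclideanLin V) (toEuclideanLin Q)) (modelLaw n d σc σz)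
      (modelLaw n d σc σz) :=
  MeasurePreserving.prod
    ⟨(continuous_toEuclideanLin V).measurable, isoGaussian_map_toEuclideanLin hV (by positivity)⟩
    ⟨(continuous_toEuclideanLin Q).measurable, isoGaussian_map_toEuclideanLin hQ (by positivity)⟩

theorem robustRisk_conj_le (hε : 0 ≤ ε) {V : Matrix (Fin d) (Fin d) ℝ}
    {Q : Matrix (Fin n) (Fin n) ℝ} (hV : Vᵀ * V = 1) (hQ : Qᵀ * Q = 1) (hQV : Q * U = U * V)
    (H : Matrix (Fin n) (Fin n) ℝ) :
    robustRisk U σc σz ε (linEst (Qᵀ * H * Q)) ≤ robustRisk U σc σz ε (linEst H) := by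
  have hpres : MeasurePreserving _ (modelLaw n d σc σz) (modelLaw n d σc σz) :=
    measurePreserving_modelLaw (mul_eq_one_comm.1 hV) (mul_eq_one_comm.1 hQ)
  have hint := worstCaseError_integrable U σc σz hε H
  set F := fun p : EuclideanSpace ℝ (Fin d) × EuclideanSpace ℝ (Fin n) ↦
    worstCaseError ε (linEst H) (toEuclideanLin U p.1) p.2
  have hpointwise (p : EuclideanSpace ℝ (Fin d) × EuclideanSpace ℝ (Fin n)) :
      worstCaseError ε (linEst (Qᵀ * H * Q)) (toEuclideanLin U p.1) p.2 ≤
        F (Prod.map (toEuclideanLin V) (toEuclideanLin Q) p) := by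
    have h := worstCaseError_conj_le hQ hε H (toEuclideanLin U p.1) p.2
    rwa [← toEuclideanLin_mul_apply, hQV, toEuclideanLin_mul_apply] at h
  calc robustRisk U σc σz ε (linEst (Qᵀ * H * Q))
      ≤ ∫ p, F (Prod.map (toEuclideanLin V) (toEuclideanLin Q) p) ∂(modelLaw n d σc σz) :=
        integral_mono (worstCaseError_integrable U σc σz hε _)
          (hpres.integrable_comp_of_integrable hint) hpointwise
    _ = ∫ p, F p ∂((modelLaw n d σc σz).map _) :=
        (integral_map hpres.aemeasurable (by rw [hpres.map_eq]; exact hint.1)).symm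
    _ = robustRisk U σc σz ε (linEst H) := by rw [hpres.map_eq]; rfl

theorem robustRisk_trace_smul_projection_le [NeZero d] (hU : Uᵀ * U = 1) (hε : 0 ≤ ε)
    (H : Matrix (Fin n) (Fin n) ℝ) :
    robustRisk U σc σz ε (linEst (((Uᵀ * H * U).trace / d) • (U * Uᵀ))) ≤
      robustRisk U σc σz ε (linEst H) := by
  have hsublevel := (convexOn_robustRisk (U := U) (σc := σc) (σz := σz) hε).convex_le
    (robustRisk U σc σz ε (linEst H))
  set N : ℝ := (Fintype.card (Fin d → ℤˣ) : ℝ) with hN_def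
  have hN : 0 < N := Nat.cast_pos.2 Fintype.card_pos
  have hd : (0 : ℝ) < d := Nat.cast_pos.2 (NeZero.pos d)
  have hweights : ∑ _x : (Fin d → ℤˣ) × Fin d, (N * d)⁻¹ = 1 := by
    rw [Finset.sum_const, Finset.card_univ, Fintype.card_prod, Fintype.card_fin, nsmul_eq_mul,
      Nat.cast_mul]
    exact mul_inv_cancel₀ (by positivity)
  have hscale (t : ℝ) : (N * d)⁻¹ * (N * t) = t / d := by field_simp
  have hmem := hsublevel.sum_mem (fun _ _ ↦ by positivity) hweights
    fun (x : (Fin d → ℤˣ) × Fin d) _ ↦ ⟨Set.mem_univ _,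
      (robustRisk_conj_le hε (signedShift_transpose_mul_self x.1 x.2)
        (extendOrthogonal_transpose_mul_self hU (signedShift_transpose_mul_self x.1 x.2))
        (extendOrthogonal_mul hU _) (U * Uᵀ * H)).trans (robustRisk_projection_mul_le hU hε H)⟩
  rw [← Finset.smul_sum, sum_extendOrthogonal_signedShift_conj hU, smul_smul,
    ← hN_def, hscale] at hmem
  exact hmem.2

end RobustRisk

section ProjectionRisk

open Matrix

variable {n d : ℕ} {U : Matrix (Fin n) (Fin d) ℝ} {σc σz ε : ℝ}

/-- The robust risk of the estimator `a U Uᵀ` in dimension `d` for the aspect ratio `r = d/n`. -/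
noncomputable def projectionRisk (d : ℕ) (σc σz ε r a : ℝ) : ℝ :=
  shrinkageVariance σc σz r a +
    2 * (ε * |a|) * (√(shrinkageVariance σc σz r a) * meanNormRatio d) + (ε * |a|) ^ 2

theorem robustRisk_smul_projection [NeZero d] (hU : Uᵀ * U = 1) (hε : 0 ≤ ε) (a : ℝ) :
    robustRisk U σc σz ε (linEst (a • (U * Uᵀ))) = projectionRisk d σc σz ε (d / n) a := by
  have hs : 0 ≤ shrinkageVariance σc σz (d / n) a := shrinkageVariance_nonneg (by positivity) a
  have hd : (d : ℝ) ≠ 0 := NeZero.ne _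
  have hcov : (σc ^ 2 / d) • (((a - 1) • (1 : Matrix (Fin d) (Fin d) ℝ)) * ((a - 1) • 1)ᵀ) +
      (σz ^ 2 / n) • ((a • Uᵀ) * (a • Uᵀ)ᵀ) = (shrinkageVariance σc σz (d / n) a / d) • 1 := by
    simp only [transpose_smul, transpose_transpose, transpose_one, Matrix.smul_mul,
      Matrix.mul_smul, Matrix.mul_one, hU, smul_smul, ← add_smul]
    congr 1
    rw [shrinkageVariance]
    field_simp
  have herror := isoGaussian_prod_map_add (by positivity) (by positivity) (by positivity) hcov
  calc robustRisk U σc σz ε (linEst (a • (U * Uᵀ)))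
      = ∫ p, (‖toEuclideanLin ((a - 1) • 1) p.1 + toEuclideanLin (a • Uᵀ) p.2‖ + ε * |a|) ^ 2
          ∂(modelLaw n d σc σz) := by
        simp_rw [robustRisk, worstCaseError_smul_projection hU hε, map_smul,
          LinearMap.smul_apply, toEuclideanLin_one_apply]
    _ = ∫ x, (‖x‖ + ε * |a|) ^ 2 ∂(isoGaussian d (shrinkageVariance σc σz (d / n) a / d)) := by
        rw [← herror, integral_map (by fun_prop) (by fun_prop), modelLaw]
    _ = projectionRisk d σc σz ε (d / n) a := integral_norm_add_const_sq_isoGaussian hs _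

theorem projectionRisk_trace_le_robustRisk [NeZero d] (hU : Uᵀ * U = 1) (hε : 0 ≤ ε)
    (H : Matrix (Fin n) (Fin n) ℝ) :
    projectionRisk d σc σz ε (d / n) ((Uᵀ * H * U).trace / d) ≤ robustRisk U σc σz ε (linEst H) :=
  (robustRisk_smul_projection hU hε _).symm.trans_le (robustRisk_trace_smul_projection_le hU hε H)

end ProjectionRisk

/-! ### Strict convexity -/

section StrictConvexity

theorem eq_zero_of_ae_norm_le {E F : Type*} [NormedAddCommGroup E]
    [NormedSpace ℝ E] [NormedAddCommGroup F] [NormedSpace ℝ F] [MeasurableSpace E] {μ : Measure E}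
    [μ.IsOpenPosMeasure] (f : E →L[ℝ] F) {C : ℝ} (h : ∀ᵐ x ∂μ, ‖f x‖ ≤ C) : f = 0 := by
  have hbounded (x : E) : ‖f x‖ ≤ C := by
    have hclosed : IsClosed {x | ‖f x‖ ≤ C} := isClosed_le (by fun_prop) continuous_const
    exact hclosed.closure_subset ((Measure.dense_of_ae h) x)
  by_contra hf
  obtain ⟨x, hx⟩ : ∃ x, f x ≠ 0 := by
    by_contra! hzero
    exact hf (ContinuousLinearMap.ext hzero)
  have hlarge := hbounded (((C + 1) / ‖f x‖) • x)
  rw [map_smul, norm_smul, norm_div, norm_norm, div_mul_cancel₀ _ (norm_ne_zero_iff.2 hx)] at hlarge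
  linarith [Real.le_norm_self (C + 1)]

theorem isOpenPosMeasure_isoGaussian (k : ℕ) {v : ℝ} (hv : 0 < v) :
    (isoGaussian k v).IsOpenPosMeasure := by
  have : (gaussianReal 0 1).IsOpenPosMeasure :=
    (gaussianReal_absolutelyContinuous' 0 one_ne_zero).isOpenPosMeasure
  have : (stdGaussian (EuclideanSpace ℝ (Fin k))).IsOpenPosMeasure := by
    rw [← map_pi_eq_stdGaussian]
    exact (PiLp.continuous_toLp 2 _).isOpenPosMeasure_map (WithLp.toLp_surjective 2)
  rw [isoGaussian_eq_map_stdGaussian hv.le]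
  refine (continuous_const_smul (√v)).isOpenPosMeasure_map fun x ↦ ⟨(√v)⁻¹ • x, ?_⟩
  exact smul_inv_smul₀ (Real.sqrt_pos.2 hv).ne' x

open Matrix

variable {n d : ℕ} {U : Matrix (Fin n) (Fin d) ℝ} {σc σz ε : ℝ}

/- Equality in the convexity inequality would give, for almost every noise `z`, a perturbation `e`
with `(G - H) (x + z + e) = 0`, so that `(G - H) z` would be bounded. -/
theorem exists_ae_norm_toEuclideanLin_sub_le (hε : 0 ≤ ε) {s t : ℝ} (hs : 0 < s)
    (ht : 0 < t) (hst : s + t = 1) {G H : Matrix (Fin n) (Fin n) ℝ}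
    (heq : robustRisk U σc σz ε (linEst (s • G + t • H)) =
      s * robustRisk U σc σz ε (linEst G) + t * robustRisk U σc σz ε (linEst H)) :
    ∃ C, ∀ᵐ z ∂(isoGaussian n (σz ^ 2 / n)), ‖toEuclideanLin (G - H) z‖ ≤ C := by
  have hG := (worstCaseError_integrable U σc σz hε G).const_mul s
  have hH := (worstCaseError_integrable U σc σz hε H).const_mul t
  have hae := (integral_eq_iff_of_ae_le (worstCaseError_integrable U σc σz hε (s • G + t • H))
    (hG.add hH) (ae_of_all _ fun p ↦
      worstCaseError_smul_add_smul_le hε hs.le ht.le hst G H (toEuclideanLin U p.1) p.2)).1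
    (heq.trans (by rw [integral_add' hG hH, integral_const_mul, integral_const_mul]; rfl))
  obtain ⟨c, hc⟩ := (Measure.ae_ae_of_ae_prod hae).exists
  set x := toEuclideanLin U c
  let f := LinearMap.toContinuousLinearMap (toEuclideanLin (G - H))
  refine ⟨‖f‖ * (‖x‖ + ε), hc.mono fun z hz ↦ ?_⟩
  obtain ⟨e, he, hgap⟩ := exists_worstCaseError_smul_add_smul_le hε hs.le ht.le hst G H x z
  have hzero : f (x + z + e) = 0 := by
    have hz : worstCaseError ε (linEst (s • G + t • H)) x z =
      s * worstCaseError ε (linEst G) x z + t * worstCaseError ε (linEst H) x z := hz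
    have hle : s * t * ‖f (x + z + e)‖ ^ 2 ≤ 0 := by
      change s * t * ‖linEst (G - H) (x + z + e)‖ ^ 2 ≤ 0
      linarith
    by_contra hne
    have := norm_pos_iff.2 hne
    exact hle.not_gt (by positivity)
  have hfz : f z = -f (x + e) := by
    rw [eq_neg_iff_add_eq_zero, ← map_add, ← hzero]
    congr 1
    abel
  change ‖f z‖ ≤ _
  rw [hfz, norm_neg]
  exact f.le_of_opNorm_le_of_le le_rfl (norm_add_le_of_le le_rfl he)

theorem strictConvexOn_robustRisk (hσz : σz ≠ 0) (hε : 0 ≤ ε) :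
    StrictConvexOn ℝ Set.univ
      (fun H : Matrix (Fin n) (Fin n) ℝ ↦ robustRisk U σc σz ε (linEst H)) := by
  refine ⟨convex_univ, fun G _ H _ hGH s t hs ht hst ↦ ?_⟩
  refine lt_of_le_of_ne
    ((convexOn_robustRisk hε).2 (Set.mem_univ G) (Set.mem_univ H) hs.le ht.le hst) fun heq ↦ ?_
  rcases eq_or_ne n 0 with rfl | hn
  · exact hGH (Subsingleton.elim G H)
  have : (0 : ℝ) < n := Nat.cast_pos.2 (Nat.pos_of_ne_zero hn)
  have := isOpenPosMeasure_isoGaussian n (v := σz ^ 2 / n) (by positivity)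
  obtain ⟨C, hC⟩ := exists_ae_norm_toEuclideanLin_sub_le hε hs ht hst heq
  have hzero := eq_zero_of_ae_norm_le
    (LinearMap.toContinuousLinearMap (toEuclideanLin (G - H))) hC
  rw [LinearEquiv.map_eq_zero_iff, LinearEquiv.map_eq_zero_iff, sub_eq_zero] at hzero
  exact hGH hzero

end StrictConvexity

/-! ### Asymptotics -/

section Asymptotics

open Matrix Filter

variable {n d : ℕ} {U : Matrix (Fin n) (Fin d) ℝ} {σc σz ε r : ℝ}

theorem mul_limitRisk_le_projectionRisk (d : ℕ) (hr : 0 ≤ r) (a : ℝ) :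
    meanNormRatio d * limitRisk σc σz ε r a ≤ projectionRisk d σc σz ε r a := by
  rw [limitRisk, projectionRisk]
  have hs := Real.sq_sqrt (shrinkageVariance_nonneg (σc := σc) (σz := σz) hr a)
  have hκ : 0 ≤ 1 - meanNormRatio d := sub_nonneg.2 (meanNormRatio_le_one d)
  set s := √(shrinkageVariance σc σz r a)
  rw [← hs]
  nlinarith [mul_nonneg hκ (sq_nonneg s), mul_nonneg hκ (sq_nonneg (ε * |a|))]

theorem projectionRisk_le_limitRisk (d : ℕ) (hε : 0 ≤ ε) (hr : 0 ≤ r) (a : ℝ) :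
    projectionRisk d σc σz ε r a ≤ limitRisk σc σz ε r a := by
  rw [limitRisk, projectionRisk, add_sq',
    Real.sq_sqrt (shrinkageVariance_nonneg (σc := σc) (σz := σz) hr a)]
  have hκ : √(shrinkageVariance σc σz r a) * meanNormRatio d ≤ √(shrinkageVariance σc σz r a) :=
    mul_le_of_le_one_right (Real.sqrt_nonneg _) (meanNormRatio_le_one d)
  have hcross := mul_le_mul_of_nonneg_left hκ (show 0 ≤ 2 * (ε * |a|) by positivity)
  linarith

theorem projectionRisk_shrinkage_add_le (hσc : 0 ≤ σc) (hσz : 0 ≤ σz) (hε : 0 ≤ ε) (hr : 0 ≤ r)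
    (d : ℕ) (a : ℝ) :
    projectionRisk d σc σz ε r (shrinkage σc σz ε r) + meanNormRatio d *
        ((|σc ^ 2 - ε ^ 2| + σz ^ 2 * r) * (a - shrinkage σc σz ε r) ^ 2) ≤
      projectionRisk d σc σz ε r a + (1 - meanNormRatio d) * σc ^ 2 := by
  set α := shrinkage σc σz ε r
  have hupper := projectionRisk_le_limitRisk (σc := σc) (σz := σz) d hε hr α
  have hlower := mul_limitRisk_le_projectionRisk (σc := σc) (σz := σz) (ε := ε) d hr a
  have hgrowth := mul_le_mul_of_nonneg_left (limitRisk_growth hσc hσz hε hr a)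
    (meanNormRatio_nonneg d)
  have hgap := mul_le_mul_of_nonneg_left (limitRisk_shrinkage_le hσc hσz hε hr)
    (sub_nonneg.2 (meanNormRatio_le_one d))
  linarith

theorem robustRisk_shrinkage_le_add [NeZero d] (hU : Uᵀ * U = 1) (hσc : 0 ≤ σc) (hσz : 0 ≤ σz)
    (hε : 0 ≤ ε) (H : Matrix (Fin n) (Fin n) ℝ) :
    robustRisk U σc σz ε (linEst (shrinkage σc σz ε (d / n) • (U * Uᵀ))) ≤
      robustRisk U σc σz ε (linEst H) + (1 - meanNormRatio d) * σc ^ 2 := by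
  rw [robustRisk_smul_projection hU hε]
  have hr : 0 ≤ (d : ℝ) / n := by positivity
  set a := (Uᵀ * H * U).trace / d
  have hκ := meanNormRatio_nonneg d
  calc projectionRisk d σc σz ε (d / n) (shrinkage σc σz ε (d / n))
      ≤ projectionRisk d σc σz ε (d / n) a + (1 - meanNormRatio d) * σc ^ 2 :=
        (le_add_of_nonneg_right (by positivity)).trans
          (projectionRisk_shrinkage_add_le hσc hσz hε hr d a)
    _ ≤ robustRisk U σc σz ε (linEst H) + (1 - meanNormRatio d) * σc ^ 2 := by
        gcongr
        exact projectionRisk_trace_le_robustRisk hU hε H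

theorem exists_isMinOn_projectionRisk (d : ℕ) (σc : ℝ) (hσz : σz ≠ 0) (hε : 0 ≤ ε) (hr : 0 < r) :
    ∃ a, IsMinOn (projectionRisk d σc σz ε r) Set.univ a := by
  have hcont : Continuous (projectionRisk d σc σz ε r) := by
    unfold projectionRisk shrinkageVariance
    fun_prop
  have hcoercive (a : ℝ) : σz ^ 2 * r * ‖a‖ ^ 2 ≤ projectionRisk d σc σz ε r a := by
    have := meanNormRatio_nonneg d
    have hvar : σz ^ 2 * r * ‖a‖ ^ 2 ≤ shrinkageVariance σc σz r a := by
      rw [shrinkageVariance, Real.norm_eq_abs, sq_abs, mul_comm (a ^ 2)]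
      exact le_add_of_nonneg_left (by positivity)
    rw [projectionRisk, add_assoc]
    exact hvar.trans (le_add_of_nonneg_right (by positivity))
  have hlim : Tendsto (fun a : ℝ ↦ σz ^ 2 * r * ‖a‖ ^ 2) (cocompact ℝ) atTop :=
    ((tendsto_pow_atTop two_ne_zero).comp (tendsto_norm_cocompact_atTop)).const_mul_atTop
      (by positivity)
  obtain ⟨a, ha⟩ := hcont.exists_forall_le (tendsto_atTop_mono hcoercive hlim)
  exact ⟨a, fun b _ ↦ ha b⟩

theorem robustRisk_lt_of_isMinOn_projectionRisk [NeZero d] (hU : Uᵀ * U = 1) (hσz : σz ≠ 0)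
    (hε : 0 ≤ ε) {a : ℝ} (ha : IsMinOn (projectionRisk d σc σz ε (d / n)) Set.univ a)
    {H : Matrix (Fin n) (Fin n) ℝ} (hH : H ≠ a • (U * Uᵀ)) :
    robustRisk U σc σz ε (linEst (a • (U * Uᵀ))) < robustRisk U σc σz ε (linEst H) := by
  have hle (G : Matrix (Fin n) (Fin n) ℝ) :
      robustRisk U σc σz ε (linEst (a • (U * Uᵀ))) ≤ robustRisk U σc σz ε (linEst G) := by
    rw [robustRisk_smul_projection hU hε]
    exact (ha (Set.mem_univ _)).trans (projectionRisk_trace_le_robustRisk hU hε G)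
  refine (hle H).lt_of_ne fun heq ↦ hH ?_
  exact (strictConvexOn_robustRisk hσz hε).eq_of_isMinOn (fun G _ ↦ heq.symm.trans_le (hle G))
    (fun G _ ↦ hle G) (Set.mem_univ _) (Set.mem_univ _)

theorem abs_sub_shrinkage_le_of_isMinOn (hσc : 0 ≤ σc) (hσz : 0 ≤ σz) (hε : 0 ≤ ε) (hr : 0 ≤ r)
    {a C δ : ℝ} (ha : IsMinOn (projectionRisk d σc σz ε r) Set.univ a) (hC : 0 < C)
    (hCr : C ≤ |σc ^ 2 - ε ^ 2| + σz ^ 2 * r) (hδ : 0 ≤ δ) (hκ : 1 / 2 ≤ meanNormRatio d)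
    (hκδ : (1 - meanNormRatio d) * σc ^ 2 ≤ 1 / 2 * (C * δ ^ 2)) :
    |a - shrinkage σc σz ε r| ≤ δ := by
  set α := shrinkage σc σz ε r
  have hmin : projectionRisk d σc σz ε r a ≤ projectionRisk d σc σz ε r α := ha (Set.mem_univ α)
  have hdist : 1 / 2 * (C * (a - α) ^ 2) ≤ 1 / 2 * (C * δ ^ 2) := calc
    1 / 2 * (C * (a - α) ^ 2)
      ≤ meanNormRatio d * ((|σc ^ 2 - ε ^ 2| + σz ^ 2 * r) * (a - α) ^ 2) := by gcongr
    _ ≤ (1 - meanNormRatio d) * σc ^ 2 := by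
      linarith [projectionRisk_shrinkage_add_le hσc hσz hε hr d a]
    _ ≤ 1 / 2 * (C * δ ^ 2) := hκδ
  exact abs_le_of_sq_le_sq (le_of_mul_le_mul_left (by linarith) hC) hδ

theorem eventually_one_sub_meanNormRatio_mul_le (c : ℝ) {η : ℝ} (hη : 0 < η) :
    ∀ᶠ d in atTop, (1 - meanNormRatio d) * c ≤ η := by
  have hlim : Tendsto (fun d ↦ (1 - meanNormRatio d) * c) atTop (nhds ((1 - 1) * c)) :=
    (tendsto_const_nhds.sub tendsto_meanNormRatio).mul_const _
  rw [sub_self, zero_mul] at hlim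
  exact hlim.eventually_le_const hη

theorem exists_pos_le_abs_sub_add (hσc : 0 ≤ σc) (hσz : σz ≠ 0) (hε : 0 ≤ ε) (K : ℝ) :
    ∃ C > 0, ∀ r : ℝ, 0 ≤ r → (ε ≠ σc ∨ 1 ≤ K * r) → C ≤ |σc ^ 2 - ε ^ 2| + σz ^ 2 * r := by
  rcases eq_or_ne ε σc with rfl | hne
  · refine ⟨σz ^ 2 / max K 1, by positivity, fun r hr hK ↦ ?_⟩
    have hr1 : 1 ≤ max K 1 * r := (hK.resolve_left (not_not.2 rfl)).trans
      (mul_le_mul_of_nonneg_right (le_max_left K 1) hr)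
    rw [sub_self, abs_zero, zero_add, div_le_iff₀ (by positivity), mul_assoc, mul_comm r]
    exact le_mul_of_one_le_right (by positivity) hr1
  · refine ⟨|σc ^ 2 - ε ^ 2|, abs_pos.2 ?_, fun r hr _ ↦ le_add_of_nonneg_right (by positivity)⟩
    rwa [sub_ne_zero, Ne, sq_eq_sq₀ hσc hε, eq_comm]

theorem pos_of_transpose_mul_self_eq_one [NeZero d] (hU : Uᵀ * U = 1) : 0 < n := by
  refine Nat.pos_of_ne_zero ?_
  rintro rfl
  have h := congrFun₂ hU 0 0
  simp [mul_apply] at h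

theorem eventually_robustRisk_shrinkage_le_add (hσc : 0 ≤ σc) (hσz : 0 ≤ σz) (hε : 0 ≤ ε)
    {δ : ℝ} (hδ : 0 < δ) :
    ∀ᶠ d : ℕ in atTop, ∀ (n : ℕ) (U : Matrix (Fin n) (Fin d) ℝ), Uᵀ * U = 1 →
      ∀ H : Matrix (Fin n) (Fin n) ℝ,
        robustRisk U σc σz ε (linEst (shrinkage σc σz ε (d / n) • (U * Uᵀ))) ≤
          robustRisk U σc σz ε (linEst H) + δ := by
  filter_upwards [eventually_one_sub_meanNormRatio_mul_le (σc ^ 2) hδ, eventually_gt_atTop 0]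
    with d hκ hd n U hU H
  have := NeZero.of_pos hd
  exact (robustRisk_shrinkage_le_add hU hσc hσz hε H).trans (by gcongr)

theorem eventually_exists_minimizer_robustRisk (hσc : 0 ≤ σc) (hσz : 0 < σz) (hε : 0 ≤ ε)
    {δ : ℝ} (hδ : 0 < δ) (K : ℝ) :
    ∀ᶠ d : ℕ in atTop, ∀ n : ℕ, (ε ≠ σc ∨ (n : ℝ) ≤ K * d) →
      ∀ U : Matrix (Fin n) (Fin d) ℝ, Uᵀ * U = 1 →
        ∃ a : ℝ, |a - shrinkage σc σz ε (d / n)| ≤ δ ∧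
          ∀ H : Matrix (Fin n) (Fin n) ℝ, H ≠ a • (U * Uᵀ) →
            robustRisk U σc σz ε (linEst (a • (U * Uᵀ))) < robustRisk U σc σz ε (linEst H) := by
  obtain ⟨C, hC, hCr⟩ := exists_pos_le_abs_sub_add hσc hσz.ne' hε K
  filter_upwards [eventually_one_sub_meanNormRatio_mul_le (σc ^ 2)
      (show 0 < 1 / 2 * (C * δ ^ 2) by positivity),
    tendsto_meanNormRatio.eventually_const_le one_half_lt_one, eventually_gt_atTop 0]
    with d hκδ hκ hd n hK U hU
  have := NeZero.of_pos hd
  have hn : (0 : ℝ) < n := Nat.cast_pos.2 (pos_of_transpose_mul_self_eq_one hU)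
  have hr : 0 < (d : ℝ) / n := by positivity
  obtain ⟨a, ha⟩ := exists_isMinOn_projectionRisk d σc hσz.ne' hε hr
  have hKr : ε ≠ σc ∨ 1 ≤ K * (d / n) := by rwa [← mul_div_assoc, one_le_div hn]
  exact ⟨a, abs_sub_shrinkage_le_of_isMinOn hσc hσz.le hε hr.le ha hC (hCr _ hr.le hKr) hδ.le hκ
    hκδ, fun H ↦ robustRisk_lt_of_isMinOn_projectionRisk hU hσz.ne' hε ha⟩

end Asymptotics

theorem theorem1_general (σc σz ε : ℝ) (hσc : 0 ≤ σc) (hσz : 0 ≤ σz) (hε : 0 ≤ ε) :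
    (∀ δ : ℝ, 0 < δ → ∃ D : ℕ, ∀ d n : ℕ, D ≤ d →
      ∀ U : Matrix (Fin n) (Fin d) ℝ, U.transpose * U = 1 →
        ∀ H : Matrix (Fin n) (Fin n) ℝ,
          robustRisk U σc σz ε (linEst (shrinkage σc σz ε ((d : ℝ) / n) • (U * U.transpose)))
            ≤ robustRisk U σc σz ε (linEst H) + δ) ∧
    (0 < σz → ∀ δ : ℝ, 0 < δ → ∀ K : ℝ, ∃ D : ℕ, ∀ d n : ℕ, D ≤ d →
      (ε ≠ σc ∨ (n : ℝ) ≤ K * d) →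
      ∀ U : Matrix (Fin n) (Fin d) ℝ, U.transpose * U = 1 →
        ∃ a : ℝ, |a - shrinkage σc σz ε ((d : ℝ) / n)| ≤ δ ∧
          ∀ H : Matrix (Fin n) (Fin n) ℝ, H ≠ a • (U * U.transpose) →
            robustRisk U σc σz ε (linEst (a • (U * U.transpose)))
              < robustRisk U σc σz ε (linEst H)) := by
  refine ⟨fun δ hδ ↦ ?_, fun hσz0 δ hδ K ↦ ?_⟩
  · obtain ⟨D, hD⟩ := Filter.eventually_atTop.1
      (eventually_robustRisk_shrinkage_le_add hσc hσz hε hδ)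
    exact ⟨D, fun d n hd ↦ hD d hd n⟩
  · obtain ⟨D, hD⟩ := Filter.eventually_atTop.1
      (eventually_exists_minimizer_robustRisk hσc hσz0 hε hδ K)
    exact ⟨D, fun d n hd ↦ hD d hd n⟩

theorem theorem1 (σc σz ε : ℝ) (hσc : 0 ≤ σc) (hσz : 0 ≤ σz) (hε : 0 ≤ ε) :
    -- the scaled projection is asymptotically risk-optimal among the symmetric linear estimators
    (∀ δ : ℝ, 0 < δ → ∃ D : ℕ, ∀ d n : ℕ, D ≤ d → d ≤ n →
      ∀ U : Matrix (Fin n) (Fin d) ℝ, U.transpose * U = 1 →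
        ∀ H : Matrix (Fin n) (Fin n) ℝ, H.IsSymm →
          robustRisk U σc σz ε (linEst (shrinkage σc σz ε ((d : ℝ) / n) • (U * U.transpose)))
            ≤ robustRisk U σc σz ε (linEst H) + δ) ∧
    -- the unique minimizer is a scaled projection whose factor converges to the stated one
    (0 < σz → ∀ δ : ℝ, 0 < δ → ∀ K : ℝ, ∃ D : ℕ, ∀ d n : ℕ, D ≤ d → d ≤ n →
      (ε ≠ σc ∨ (n : ℝ) ≤ K * d) →
      ∀ U : Matrix (Fin n) (Fin d) ℝ, U.transpose * U = 1 →
        ∃ a : ℝ, |a - shrinkage σc σz ε ((d : ℝ) / n)| ≤ δ ∧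
          ∀ H : Matrix (Fin n) (Fin n) ℝ, H.IsSymm → H ≠ a • (U * U.transpose) →
            robustRisk U σc σz ε (linEst (a • (U * U.transpose)))
              < robustRisk U σc σz ε (linEst H)) := by
  obtain ⟨hoptimal, hminimizer⟩ := theorem1_general σc σz ε hσc hσz hε
  exact ⟨fun δ hδ ↦ (hoptimal δ hδ).imp fun _ hD d n hd _ U hU H _ ↦ hD d n hd U hU H,
    fun hσz0 δ hδ K ↦ (hminimizer hσz0 δ hδ K).imp fun _ hD d n hd _ hK U hU ↦
      (hD d n hd hK U hU).imp fun _ ha ↦ ⟨ha.1, fun H _ ↦ ha.2 H⟩⟩
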